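/- Let $(X,d)$ be a geodesic metric space (any two points are joined by a curve realizing their distance), let $I\subseteq\mathbb R$ be an open interval (possibly unbounded) and let $f:I\to(0,\infty)$ be continuous. Equip $Y=I\times_f X=I\times X$ with the metric $D((t,x),(t',x'))=|t-t'|+d(x,x')$. A future directed causal (respectively timelike) curve in $Y$ is a $D$-absolutely continuous curve $\gamma=(\alpha,\beta):[a,b]\to Y$, $a<b$, with $\alpha$ strictly increasing, $\dot\alpha>0$ almost everywhere, and $-\dot\alpha^2+(f\circ\alpha)^2v_\beta^2\le 0$ (respectively $<0$) almost everywhere, where $v_\beta$ is the metric derivative of $\beta$. Its length is $L(\gamma)=\int_a^b\sqrt{\dot\alpha^2-(f\circ\alpha)^2v_\beta^2}$. For $p,q\in Y$ write $p\ll q$ if there is a future directed timelike curve from $p$ to $q$, and $p\le q$ if $p=q$ or there is a future directed causal curve from $p$ to $q$. Let $\tau(p,q)\in[0,\infty]$ be the supremum of $L(\gamma)$ over all future directed causal curves $\gamma$ from $p$ to $q$ ($0$ if there are none), and let $L_\tau(\gamma)=\inf\sum_{i<N}\tau(\gamma(t_i),\gamma(t_{i+1}))$, the infimum being over all partitions $a=t_0<\dots<t_N=b$.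 A future directed causal curve $\gamma$ on $[a,b]$ is maximal if $L(\gamma)=L_\tau(\gamma)=\tau(\gamma(a),\gamma(b))$, and it is a geodesic if it is locally maximal, i.e. every $t\in[a,b]$ has a neighbourhood $[c,d]$ in $[a,b]$, $c<d$, such that $\gamma|_{[c,d]}$ is maximal. Then $Y$ is geodesic: for all $p,q\in Y$ with $p\le q$ and $p\ne q$ there is a maximal future directed causal curve from $p$ to $q$. Furthermore, for all $p,q\in Y$ with $p\ll q$ there is a future directed timelike geodesic from $p$ to $q$, and it can be chosen to be maximal. In both cases the curve can be chosen Lipschitz continuous with respect to $D$. -/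

import Mathlib

open Set Filter Topology MeasureTheory
open scoped ENNReal NNReal

noncomputable section

/-- A metric space is geodesic if any two points are joined by a minimizing curve
parametrized by arclength. -/
def IsGeodesicSpace (X : Type*) [MetricSpace X] : Prop :=
  ∀ x y : X, ∃ c : ℝ → X, c 0 = x ∧ c (dist x y) = y ∧
    ∀ s ∈ Icc 0 (dist x y), ∀ t ∈ Icc 0 (dist x y), dist (c s) (c t) = |s - t|

/-- The metric derivative `v_β(t) = lim_{s → t} d(β(s), β(t)) / |s - t|`; for an absolutely
continuous curve the limit exists at almost every `t`. -/
def metricDeriv {X : Type*} [MetricSpace X] (β : ℝ → X) (t : ℝ) : ℝ :=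
  limUnder (𝓝[≠] t) (fun s => dist (β s) (β t) / |s - t|)

/-- The set `I × X` underlying the generalized cone `I ×_f X`. The warping function `f` is only
used on `I`; it is a parameter of the type because the causal structure depends on it. -/
@[ext]
structure GenCone (I : Set ℝ) (f : ℝ → ℝ) (X : Type*) where
  base : ℝ
  base_mem : base ∈ I
  fiber : X

namespace GenCone

variable {I : Set ℝ} {f : ℝ → ℝ} {X : Type*} [MetricSpace X]

/-- The product metric `D((t,x),(t',x')) = |t - t'| + d(x,x')`. -/
instance : MetricSpace (GenCone I f X) where
  dist p q := |p.base - q.base| + dist p.fiber q.fiber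
  dist_self p := by simp
  dist_comm p q := by simp only [abs_sub_comm, dist_comm]
  dist_triangle p q r := by
    have h1 := abs_sub_le p.base q.base r.base
    have h2 := dist_triangle p.fiber q.fiber r.fiber
    linarith
  eq_of_dist_eq_zero {p q} h := by
    have h1 : 0 ≤ |p.base - q.base| := abs_nonneg _
    have h2 : 0 ≤ dist p.fiber q.fiber := dist_nonneg
    have h' : |p.base - q.base| + dist p.fiber q.fiber = 0 := h
    have h3 : |p.base - q.base| = 0 := by linarith
    have h4 : dist p.fiber q.fiber = 0 := by linarith
    exact GenCone.ext (sub_eq_zero.mp (abs_eq_zero.mp h3)) (dist_eq_zero.mp h4)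

/-- The quantity `-α'(t)² + f(α(t))² v_β(t)²` of a curve `γ = (α, β)`. -/
def velocitySq (γ : ℝ → GenCone I f X) (t : ℝ) : ℝ :=
  -(deriv (fun s => (γ s).base) t) ^ 2 +
    f (γ t).base ^ 2 * metricDeriv (fun s => (γ s).fiber) t ^ 2

/-- Curves `γ = (α, β) : [a, b] → I ×_f X`, `a < b`, that are absolutely continuous for `D` and
have strictly monotone base component. Values of `γ` outside `[a, b]` play no role. -/
structure IsConeCurve (γ : ℝ → GenCone I f X) (a b : ℝ) : Prop where
  lt : a < b
  ac : AbsolutelyContinuousOnInterval γ a b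
  mono : StrictMonoOn (fun s => (γ s).base) (Icc a b) ∨
    StrictAntiOn (fun s => (γ s).base) (Icc a b)

def IsCausal (γ : ℝ → GenCone I f X) (a b : ℝ) : Prop :=
  IsConeCurve γ a b ∧ ∀ᵐ t ∂(volume.restrict (Icc a b)), velocitySq γ t ≤ 0

def IsTimelike (γ : ℝ → GenCone I f X) (a b : ℝ) : Prop :=
  IsConeCurve γ a b ∧ ∀ᵐ t ∂(volume.restrict (Icc a b)), velocitySq γ t < 0

def IsFutureDirected (γ : ℝ → GenCone I f X) (a b : ℝ) : Prop :=
  StrictMonoOn (fun s => (γ s).base) (Icc a b) ∧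
    ∀ᵐ t ∂(volume.restrict (Icc a b)), 0 < deriv (fun s => (γ s).base) t

/-- The length `L(γ) = ∫_a^b √(α'² - (f ∘ α)² v_β²)`, as an element of `[0, ∞]`. -/
def length (γ : ℝ → GenCone I f X) (a b : ℝ) : ℝ≥0∞ :=
  ∫⁻ t in Icc a b, ENNReal.ofReal (Real.sqrt (-velocitySq γ t))

/-- The time separation function: the supremum of the lengths of the future directed causal
curves from `p` to `q`, which is `0` if there are none. -/
def timeSep (p q : GenCone I f X) : ℝ≥0∞ :=
  ⨆ (a : ℝ) (b : ℝ) (γ : ℝ → GenCone I f X)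
    (_ : IsCausal γ a b ∧ IsFutureDirected γ a b ∧ γ a = p ∧ γ b = q), length γ a b

/-- The chronological relation `p ≪ q`. -/
def TimelikeRelated (p q : GenCone I f X) : Prop :=
  ∃ (a b : ℝ) (γ : ℝ → GenCone I f X),
    IsTimelike γ a b ∧ IsFutureDirected γ a b ∧ γ a = p ∧ γ b = q

/-- The causal relation `p ≤ q`. -/
def CausallyRelated (p q : GenCone I f X) : Prop :=
  (∃ (a b : ℝ) (γ : ℝ → GenCone I f X),
    IsCausal γ a b ∧ IsFutureDirected γ a b ∧ γ a = p ∧ γ b = q) ∨ p = q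

/-- The `τ`-length: the infimum of `∑ τ(γ(t_i), γ(t_{i+1}))` over all partitions
`a = t_0 < t_1 < ... < t_N = b`. -/
def tauLength (γ : ℝ → GenCone I f X) (a b : ℝ) : ℝ≥0∞ :=
  ⨅ (N : ℕ) (t : ℕ → ℝ) (_ : t 0 = a ∧ t N = b ∧ ∀ i < N, t i < t (i + 1)),
    ∑ i ∈ Finset.range N, timeSep (γ (t i)) (γ (t (i + 1)))

/-- A future directed causal curve is maximal if it realizes the time separation of its endpoints.
Both lengths in use, `L` and the `τ`-length, are required to do so. -/
def IsMaximal (γ : ℝ → GenCone I f X) (a b : ℝ) : Prop :=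
  IsCausal γ a b ∧ IsFutureDirected γ a b ∧
    length γ a b = timeSep (γ a) (γ b) ∧ tauLength γ a b = timeSep (γ a) (γ b)

/-- A future directed geodesic is a future directed causal curve that is locally maximal: each
parameter has a neighbourhood `[c, d]` in `[a, b]` on which the curve is maximal. -/
def IsGeodesic (γ : ℝ → GenCone I f X) (a b : ℝ) : Prop :=
  IsCausal γ a b ∧ IsFutureDirected γ a b ∧
    ∀ t ∈ Icc a b, ∃ c d : ℝ, a ≤ c ∧ c < d ∧ d ≤ b ∧
      Icc c d ∈ 𝓝[Icc a b] t ∧ IsMaximal γ c d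

end GenCone

end

/-! Lengths are bounded by a calibration argument with one Lagrange multiplier `l ≥ 0`. For a causal
curve `(α, β)`, Cauchy–Schwarz gives `√(α'² - f²v²) ≤ (√(f² + l²)/f) α' - l v`, where `v` is the
metric derivative of `β`. Since `v` dominates the derivative of the distance from the initial fibre
point, integrating and changing variables along `α` bounds the length by `∫ √(f² + l²)/f - l d`,
where `d` is the distance of the fibre endpoints (`length_le`, `timeSep_le`). This bound depends
only on the endpoints.

Parametrized by the base (`α' = 1`), equality holds for `v = l/(f √(f² + l²))`. A minimizing fibre
geodesic run at this speed joins the endpoints once `∫ v = d`. Such an `l` exists when `d < ∫ 1/f`,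
by the intermediate value theorem, and the resulting curve is timelike and maximal. Integrating the
causality condition gives `d ≤ ∫ 1/f`, strictly for a timelike curve. In the borderline case `d = ∫
1/f` the bound tends to `0` as `l → ∞`, so the null curve of speed `1/f` is maximal. -/

theorem AbsolutelyContinuousOnInterval.of_dist_le {X Y : Type*} [PseudoMetricSpace X]
    [PseudoMetricSpace Y] {γ : ℝ → X} {β : ℝ → Y} {a b C : ℝ}
    (hγ : AbsolutelyContinuousOnInterval γ a b)
    (h : ∀ s ∈ uIcc a b, ∀ t ∈ uIcc a b, dist (β s) (β t) ≤ C * dist (γ s) (γ t)) :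
    AbsolutelyContinuousOnInterval β a b := by
  have hC := Filter.Tendsto.const_mul C hγ
  rw [mul_zero] at hC
  refine squeeze_zero' (Eventually.of_forall fun E => Finset.sum_nonneg fun i _ => dist_nonneg)
    ?_ hC
  refine eventually_inf_principal.2 (Eventually.of_forall fun E hE => ?_)
  rw [Finset.mul_sum]
  exact Finset.sum_le_sum fun i hi => h _ (hE.1 i hi).1 _ (hE.1 i hi).2

open BoundedContinuousFunction in
-- Kuratowski embedding by distance functions. Subtracting the distance to a base point makes them
-- bounded. It turns a curve in `X` into one in a normed space.
theorem exists_isometry_boundedContinuousFunction (X : Type*) [PseudoMetricSpace X] :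
    ∃ Φ : X → (X →ᵇ ℝ), Isometry Φ := by
  rcases isEmpty_or_nonempty X with h | ⟨⟨x₀⟩⟩
  · exact ⟨fun x => (h.false x).elim, fun x => (h.false x).elim⟩
  refine ⟨fun x => BoundedContinuousFunction.ofNormedAddCommGroup
    (fun y => dist x y - dist x₀ y) (by fun_prop) (dist x x₀)
    fun y => abs_dist_sub_le x x₀ y, Isometry.of_dist_eq fun x x' => le_antisymm ?_ ?_⟩
  · refine (BoundedContinuousFunction.dist_le dist_nonneg).2 fun y => ?_
    simpa [Real.dist_eq] using abs_dist_sub_le x x' y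
  · refine le_trans ?_ (BoundedContinuousFunction.dist_coe_le_dist x')
    simp

theorem HasDerivAt.tendsto_abs_sub_div {g : ℝ → ℝ} {g' t : ℝ} (hg : HasDerivAt g g' t) :
    Tendsto (fun s => |g s - g t| / |s - t|) (𝓝[≠] t) (𝓝 |g'|) := by
  refine (hasDerivAt_iff_tendsto_slope.1 hg).abs.congr fun s => ?_
  rw [slope_def_field, abs_div]

theorem HasDerivAt.abs_le_of_tendsto_div {g : ℝ → ℝ} {w : ℝ → ℝ} {g' v t : ℝ}
    (hg : HasDerivAt g g' t) (hw : Tendsto (fun s => w s / |s - t|) (𝓝[≠] t) (𝓝 v))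
    (h : ∀ᶠ s in 𝓝[≠] t, |g s - g t| ≤ w s) : |g'| ≤ v := by
  refine le_of_tendsto_of_tendsto hg.tendsto_abs_sub_div hw ?_
  filter_upwards [h] with s hs
  gcongr

/-! ### Metric derivatives of absolutely continuous curves -/

section MetricDeriv

variable {X : Type*} [MetricSpace X] {β : ℝ → X} {a b : ℝ}

theorem AbsolutelyContinuousOnInterval.dist_const (hβ : AbsolutelyContinuousOnInterval β a b)
    (x : X) : AbsolutelyContinuousOnInterval (fun t => dist (β t) x) a b :=
  AbsolutelyContinuousOnInterval.of_dist_le (C := 1) hβ fun s _ t _ => by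
    rw [one_mul, Real.dist_eq]
    exact abs_dist_sub_le (β s) (β t) x

theorem AbsolutelyContinuousOnInterval.continuousOn_metric
    (hβ : AbsolutelyContinuousOnInterval β a b) : ContinuousOn β (uIcc a b) := by
  intro u hu
  have h := AbsolutelyContinuousOnInterval.continuousOn
    (AbsolutelyContinuousOnInterval.dist_const hβ (β u)) u hu
  rw [ContinuousWithinAt, dist_self] at h
  exact tendsto_iff_dist_tendsto_zero.2 h

/-- The increments of the variation function `V` dominate those of every distance function, so
`|V'|` is a bound independent of `x`. It is integrable because `V` is monotone. -/
theorem AbsolutelyContinuousOnInterval.exists_ae_abs_deriv_dist_le (hab : a ≤ b)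
    (hβ : AbsolutelyContinuousOnInterval β a b) :
    ∃ k : ℝ → ℝ, IntervalIntegrable k volume a b ∧ ∀ x, ∀ᵐ t, t ∈ Ioo a b →
      |deriv (fun s => dist (β s) x) t| ≤ k t := by
  obtain ⟨Φ, hΦ⟩ := exists_isometry_boundedContinuousFunction X
  have hΦβ : AbsolutelyContinuousOnInterval (fun t => Φ (β t)) a b :=
    AbsolutelyContinuousOnInterval.of_dist_le (C := 1) hβ fun s _ t _ => by
      rw [one_mul, hΦ.dist_eq]
  have hbv := AbsolutelyContinuousOnInterval.boundedVariationOn hΦβ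
  rw [uIcc_of_le hab] at hbv
  have hl := hbv.locallyBoundedVariationOn
  have ha : a ∈ Icc a b := left_mem_Icc.2 hab
  set V := variationOnFromTo (fun t => Φ (β t)) (Icc a b) a with hV
  have hmono : MonotoneOn V (Icc a b) := variationOnFromTo.monotoneOn hl ha
  have hle : ∀ s ∈ Icc a b, ∀ t ∈ Icc a b, s ≤ t → dist (β s) (β t) ≤ V t - V s := by
    intro s hs t ht hst
    have h1 : V t - V s = variationOnFromTo (fun t => Φ (β t)) (Icc a b) s t := by
      have := variationOnFromTo.add hl ha hs ht
      simp only [hV]; linarith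
    rw [h1, ← hΦ.dist_eq, variationOnFromTo.eq_of_le _ _ hst]
    exact BoundedVariationOn.dist_le (hl s t hs ht) ⟨hs, le_rfl, hst⟩ ⟨ht, hst, le_rfl⟩
  refine ⟨fun t => |deriv V t|, ?_, fun x => ?_⟩
  · have := MonotoneOn.intervalIntegrable_deriv (f := V) (by rwa [uIcc_of_le hab])
    exact this.abs
  have h1 := (hβ.dist_const x).ae_differentiableAt
  have h2 := hmono.ae_differentiableWithinAt_of_mem
  filter_upwards [h1, h2] with t h1 h2 ht
  have htI := Ioo_subset_Icc_self ht
  have hg := (h1 (by rwa [uIcc_of_le hab])).hasDerivAt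
  have hv := ((h2 htI).differentiableAt (Icc_mem_nhds ht.1 ht.2)).hasDerivAt
  refine hg.abs_le_of_tendsto_div hv.tendsto_abs_sub_div ?_
  filter_upwards [mem_nhdsWithin_of_mem_nhds (Icc_mem_nhds ht.1 ht.2)] with s hs
  refine (abs_dist_sub_le _ _ _).trans ?_
  rcases le_total s t with h | h
  · rw [abs_sub_comm]
    exact (hle s hs t htI h).trans (le_abs_self _)
  · rw [dist_comm]
    exact (hle t htI s hs h).trans (le_abs_self _)

/-- An absolutely continuous curve is bounded by the integral of the pointwise supremum of the
derivatives of countably many distance functions. -/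
theorem AbsolutelyContinuousOnInterval.exists_ae_abs_deriv_le_iSup (hab : a ≤ b)
    (hβ : AbsolutelyContinuousOnInterval β a b) (x : ℚ → X) (m : ℝ → ℝ)
    (hm : m = fun t => ⨆ q, |deriv (fun s => dist (β s) (x q)) t|) :
    IntervalIntegrable m volume a b ∧
      ∀ᵐ t, t ∈ Ioo a b → ∀ q, |deriv (fun s => dist (β s) (x q)) t| ≤ m t := by
  obtain ⟨k, hk, hgk⟩ := hβ.exists_ae_abs_deriv_dist_le hab
  have hmm : Measurable m := by
    rw [hm]
    -- Measurability of the supremum relies on the family being countable.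
    exact Measurable.iSup fun q => (measurable_deriv _).abs
  have hbd : ∀ᵐ t, t ∈ Ioo a b → ∀ q, |deriv (fun s => dist (β s) (x q)) t| ≤ k t := by
    have := ae_all_iff.2 fun q : ℚ => hgk (x q)
    filter_upwards [this] with t ht hI q using ht q hI
  have hm0 : ∀ t, 0 ≤ m t := fun t => by
    rw [hm]
    exact Real.iSup_nonneg fun q => abs_nonneg _
  have haeI : ∀ᵐ t : ℝ, t ∈ Ioc a b → t ∈ Ioo a b := by
    have : ∀ᵐ t : ℝ, t ≠ b := by simp [ae_iff, measure_singleton]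
    filter_upwards [this] with t ht h using ⟨h.1, lt_of_le_of_ne h.2 ht⟩
  refine ⟨hk.mono_fun hmm.aestronglyMeasurable ?_, ?_⟩
  · rw [uIoc_of_le hab]
    refine (ae_restrict_iff' measurableSet_Ioc).2 ?_
    filter_upwards [hbd, haeI] with t ht hI hIoc
    rw [Real.norm_of_nonneg (hm0 t), hm]
    exact (ciSup_le fun q => ht (hI hIoc) q).trans (le_abs_self _)
  · filter_upwards [hbd] with t ht hI q
    rw [hm]
    exact le_ciSup (f := fun q => |deriv (fun s => dist (β s) (x q)) t|)
      ⟨k t, by rintro _ ⟨q, rfl⟩; exact ht hI q⟩ q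

theorem AbsolutelyContinuousOnInterval.dist_le_integral
    (hβ : AbsolutelyContinuousOnInterval β a b) {x : ℚ → X} {m : ℝ → ℝ}
    (hmi : IntervalIntegrable m volume a b)
    (hm : ∀ᵐ t, t ∈ Ioo a b → ∀ q, |deriv (fun s => dist (β s) (x q)) t| ≤ m t)
    (hx : ∀ u ∈ Icc a b, β u ∈ closure (range x)) {s t : ℝ} (hs : s ∈ Icc a b)
    (ht : t ∈ Icc a b) (hst : s ≤ t) : dist (β s) (β t) ≤ ∫ u in s..t, m u := by
  have hab : a ≤ b := hs.1.trans hs.2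
  have haeI : ∀ᵐ t : ℝ, t ∈ Ioc a b → t ∈ Ioo a b := by
    have : ∀ᵐ t : ℝ, t ≠ b := by simp [ae_iff, measure_singleton]
    filter_upwards [this] with t ht h using ⟨h.1, lt_of_le_of_ne h.2 ht⟩
  have hsubset : uIcc s t ⊆ uIcc a b := by
    rw [uIcc_of_le hab]
    exact OrdConnected.uIcc_subset ordConnected_Icc hs ht
  have hq : ∀ q, dist (β t) (x q) - dist (β s) (x q) ≤ ∫ u in s..t, m u := by
    intro q
    have hac := AbsolutelyContinuousOnInterval.mono
      (AbsolutelyContinuousOnInterval.dist_const hβ (x q)) hsubset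
    rw [← AbsolutelyContinuousOnInterval.integral_deriv_eq_sub hac]
    refine intervalIntegral.integral_mono_ae_restrict hst
      (AbsolutelyContinuousOnInterval.intervalIntegrable_deriv hac) (hmi.mono_set hsubset) ?_
    rw [← restrict_Ioc_eq_restrict_Icc]
    refine (ae_restrict_iff' measurableSet_Ioc).2 ?_
    filter_upwards [hm, haeI] with u hu hI huI
    exact (le_abs_self _).trans (hu (hI ⟨hs.1.trans_lt huI.1, huI.2.trans ht.2⟩) q)
  -- The estimate is a closed condition on the reference point, so it extends to `y = β s`, where
  -- the left side is `dist (β t) (β s)`.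
  have hcl : closure (range x) ⊆ {y | dist (β t) y - dist (β s) y ≤ ∫ u in s..t, m u} := by
    refine closure_minimal ?_ ?_
    · rintro _ ⟨q, rfl⟩
      exact hq q
    · exact isClosed_le ((continuous_const.dist continuous_id).sub
        (continuous_const.dist continuous_id)) continuous_const
  have := hcl (hx s hs)
  simpa [dist_comm] using this

theorem ContinuousOn.exists_rat_mem_closure_range (hab : a ≤ b)
    (hβ : ContinuousOn β (Icc a b)) :
    ∃ x : ℚ → X, ∀ u ∈ Icc a b, β u ∈ closure (range x) := by
  have hc : Continuous fun u => β (max a (min b u)) :=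
    hβ.comp_continuous (f := fun u => max a (min b u)) (by fun_prop) fun u =>
      ⟨le_max_left _ _, max_le hab (min_le_left _ _)⟩
  refine ⟨fun q => β (max a (min b q)), fun u hu => ?_⟩
  have hd : u ∈ closure (range ((↑) : ℚ → ℝ)) := Rat.denseRange_cast u
  have := mem_closure_image hc.continuousAt hd
  rw [← range_comp] at this
  simpa [hu.1, hu.2, Function.comp_def] using this

/-- An absolutely continuous curve has a metric derivative at almost every point. -/
theorem AbsolutelyContinuousOnInterval.ae_exists_tendsto_dist_div (hab : a ≤ b)
    (hβ : AbsolutelyContinuousOnInterval β a b) :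
    ∀ᵐ t, t ∈ Ioo a b →
      ∃ v, Tendsto (fun s => dist (β s) (β t) / |s - t|) (𝓝[≠] t) (𝓝 v) := by
  have huIcc := uIcc_of_le hab
  have hcont := AbsolutelyContinuousOnInterval.continuousOn_metric hβ
  rw [huIcc] at hcont
  obtain ⟨x, hx⟩ := hcont.exists_rat_mem_closure_range hab
  obtain ⟨m, hm⟩ : ∃ m : ℝ → ℝ, m = fun t => ⨆ q, |deriv (fun s => dist (β s) (x q)) t| :=
    ⟨_, rfl⟩
  obtain ⟨hmi, hm_ge⟩ := hβ.exists_ae_abs_deriv_le_iSup hab x m hm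
  have hm0 : ∀ t, 0 ≤ m t := fun t => by
    rw [hm]
    exact Real.iSup_nonneg fun q => abs_nonneg _
  have hsub : ∀ s ∈ Icc a b, IntervalIntegrable m volume a s := by
    intro s hs
    refine hmi.mono_set ?_
    rw [huIcc]
    exact OrdConnected.uIcc_subset ordConnected_Icc (left_mem_Icc.2 hab) hs
  have hMle : ∀ s ∈ Icc a b, ∀ t ∈ Icc a b, s ≤ t →
      dist (β s) (β t) ≤ |(∫ u in a..t, m u) - ∫ u in a..s, m u| := by
    intro s hs t ht hst
    rw [intervalIntegral.integral_interval_sub_left (hsub t ht) (hsub s hs)]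
    exact (AbsolutelyContinuousOnInterval.dist_le_integral hβ hmi hm_ge hx hs ht hst).trans
      (le_abs_self _)
  have hMd := hmi.ae_hasDerivAt_integral
  have hgd := ae_all_iff.2 fun q => AbsolutelyContinuousOnInterval.ae_differentiableAt
    (AbsolutelyContinuousOnInterval.dist_const hβ (x q))
  rw [huIcc] at hMd hgd
  filter_upwards [hMd, hgd] with t hMd hgd ht
  have htI := Ioo_subset_Icc_self ht
  -- The limit is `m t`. From below, a single distance function nearly attaining the supremum
  -- suffices; from above, Lebesgue differentiation of `∫ m` does.
  refine ⟨m t, tendsto_order.2 ⟨fun c hc => ?_, fun c hc => ?_⟩⟩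
  · rw [hm] at hc
    obtain ⟨q, hq⟩ := exists_lt_of_lt_ciSup hc
    have hd := (hgd q htI).hasDerivAt
    filter_upwards [hd.tendsto_abs_sub_div.eventually_const_lt hq] with s hs
    refine hs.trans_le ?_
    gcongr
    exact abs_dist_sub_le (β s) (β t) (x q)
  · have hd := (hMd htI a (left_mem_Icc.2 hab)).tendsto_abs_sub_div
    rw [abs_of_nonneg (hm0 t)] at hd
    filter_upwards [hd.eventually_lt_const hc,
      mem_nhdsWithin_of_mem_nhds (Icc_mem_nhds ht.1 ht.2)] with s hs hsI
    refine lt_of_le_of_lt ?_ hs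
    gcongr
    rcases le_total s t with h | h
    · rw [abs_sub_comm]
      exact hMle s hsI t htI h
    · rw [dist_comm]
      exact hMle t htI s hsI h

/-- The triangle inequality passes to the limit of difference quotients. Existence of that limit is
essential, since `limUnder` carries no information without it. -/
theorem AbsolutelyContinuousOnInterval.ae_abs_deriv_dist_le_metricDeriv (hab : a ≤ b)
    (hβ : AbsolutelyContinuousOnInterval β a b) (x : X) :
    ∀ᵐ t, t ∈ Ioo a b → |deriv (fun s => dist (β s) x) t| ≤ metricDeriv β t := by
  filter_upwards [hβ.ae_exists_tendsto_dist_div hab, (hβ.dist_const x).ae_differentiableAt]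
    with t hv hd ht
  obtain ⟨v, hv⟩ := hv ht
  have hd := (hd (by rw [uIcc_of_le hab]; exact Ioo_subset_Icc_self ht)).hasDerivAt
  rw [metricDeriv, hv.limUnder_eq]
  exact hd.abs_le_of_tendsto_div hv (Eventually.of_forall fun s => abs_dist_sub_le _ _ _)

end MetricDeriv

/-! ### Change of variables and the pointwise inequality -/

/-- An antiderivative `H` of `h` is C¹, hence Lipschitz on `[α a, α b]`, where monotonicity confines
`α`. So `H ∘ α` is absolutely continuous and the fundamental theorem applies to it. -/
theorem AbsolutelyContinuousOnInterval.integral_comp_mul_deriv_of_monotoneOn {α h : ℝ → ℝ}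
    {a b : ℝ} (hab : a ≤ b) (hα : AbsolutelyContinuousOnInterval α a b)
    (hmono : MonotoneOn α (Icc a b)) (hh : Continuous h) :
    IntervalIntegrable (fun t => h (α t) * deriv α t) volume a b ∧
      ∫ t in a..b, h (α t) * deriv α t = ∫ x in α a..α b, h x := by
  have huIcc := uIcc_of_le hab
  obtain ⟨H, hH⟩ : ∃ H : ℝ → ℝ, H = fun x => ∫ u in (0 : ℝ)..x, h u := ⟨_, rfl⟩
  have hHd : ∀ x, HasDerivAt H (h x) x := fun x => by
    rw [hH]
    exact intervalIntegral.integral_hasDerivAt_right (hh.intervalIntegrable _ _)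
      hh.aestronglyMeasurable.stronglyMeasurableAtFilter hh.continuousAt
  have hHC : ContDiff ℝ 1 H := by
    rw [contDiff_one_iff_deriv]
    refine ⟨fun x => (hHd x).differentiableAt, ?_⟩
    rwa [show deriv H = h from funext fun x => (hHd x).deriv]
  obtain ⟨K, hK⟩ := (hHC.contDiffOn (s := Icc (α a) (α b))).exists_lipschitzOnWith
    (by decide) (convex_Icc _ _) isCompact_Icc
  have hmem : ∀ t ∈ uIcc a b, α t ∈ Icc (α a) (α b) := fun t ht => by
    rw [huIcc] at ht
    exact ⟨hmono (left_mem_Icc.2 hab) ht ht.1, hmono ht (right_mem_Icc.2 hab) ht.2⟩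
  have hac : AbsolutelyContinuousOnInterval (fun t => H (α t)) a b :=
    AbsolutelyContinuousOnInterval.of_dist_le (C := K) hα fun s hs t ht =>
      hK.dist_le_mul _ (hmem s hs) _ (hmem t ht)
  have hd : ∀ᵐ t, t ∈ uIcc a b → deriv (fun t => H (α t)) t = h (α t) * deriv α t := by
    filter_upwards [AbsolutelyContinuousOnInterval.ae_differentiableAt hα] with t ht hI
    exact ((hHd (α t)).comp t (ht hI).hasDerivAt).deriv
  have hd' : ∀ᵐ t, t ∈ uIoc a b → deriv (fun t => H (α t)) t = h (α t) * deriv α t := by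
    filter_upwards [hd] with t ht hI using ht (uIoc_subset_uIcc hI)
  constructor
  · refine (AbsolutelyContinuousOnInterval.intervalIntegrable_deriv hac).congr_ae ?_
    exact (ae_restrict_iff' measurableSet_uIoc).2 hd'
  · rw [← intervalIntegral.integral_congr_ae hd',
      AbsolutelyContinuousOnInterval.integral_deriv_eq_sub hac, hH]
    exact intervalIntegral.integral_interval_sub_left (hh.intervalIntegrable _ _)
      (hh.intervalIntegrable _ _)

/-- Cauchy–Schwarz for `(F, l)` and `(√(A² - (F w)²), F w)`, the second vector having norm `A`. -/
theorem mul_sqrt_add_mul_le (F l A w : ℝ) (hA : 0 ≤ A) (hw : (F * w) ^ 2 ≤ A ^ 2) :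
    F * √(A ^ 2 - (F * w) ^ 2) + l * (F * w) ≤ √(F ^ 2 + l ^ 2) * A := by
  have h1 := Real.sq_sqrt (sub_nonneg.2 hw)
  set R := √(A ^ 2 - (F * w) ^ 2)
  refine (le_abs_self _).trans (abs_le_of_sq_le_sq ?_ (by positivity))
  rw [mul_pow, Real.sq_sqrt (by positivity)]
  have : A ^ 2 = R ^ 2 + (F * w) ^ 2 := by linarith
  rw [this]
  nlinarith [sq_nonneg (l * R - F * (F * w))]

theorem ae_restrict_Icc_of_Ioo {a b : ℝ} {P : ℝ → Prop}
    (h : ∀ᵐ t : ℝ, t ∈ Ioo a b → P t) : ∀ᵐ t ∂(volume.restrict (Icc a b)), P t := by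
  rw [← restrict_Ioo_eq_restrict_Icc]
  exact (ae_restrict_iff' measurableSet_Ioo).2 h

/-! ### Bounds for causal and timelike curves -/

namespace GenCone

variable {I : Set ℝ} {f : ℝ → ℝ} {X : Type*} {γ : ℝ → GenCone I f X} {a b : ℝ}

theorem base_mem_Icc (hmono : StrictMonoOn (fun s => (γ s).base) (Icc a b)) {t : ℝ}
    (ht : t ∈ Icc a b) : (γ t).base ∈ Icc (γ a).base (γ b).base :=
  ⟨hmono.monotoneOn (left_mem_Icc.2 (ht.1.trans ht.2)) ht ht.1,
    hmono.monotoneOn ht (right_mem_Icc.2 (ht.1.trans ht.2)) ht.2⟩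

theorem IsFutureDirected.mono (hf : IsFutureDirected γ a b) {c d : ℝ} (hac : a ≤ c)
    (hdb : d ≤ b) : IsFutureDirected γ c d :=
  ⟨hf.1.mono (Icc_subset_Icc hac hdb),
    ae_restrict_of_ae_restrict_of_subset (Icc_subset_Icc hac hdb) hf.2⟩

variable [MetricSpace X]

theorem dist_def (p q : GenCone I f X) :
    dist p q = |p.base - q.base| + dist p.fiber q.fiber := rfl

theorem IsConeCurve.ac_base (h : IsConeCurve γ a b) :
    AbsolutelyContinuousOnInterval (fun t => (γ t).base) a b :=
  AbsolutelyContinuousOnInterval.of_dist_le (C := 1) h.ac fun s _ t _ => by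
    rw [one_mul, dist_def, Real.dist_eq]
    exact le_add_of_nonneg_right dist_nonneg

theorem IsConeCurve.ac_fiber (h : IsConeCurve γ a b) :
    AbsolutelyContinuousOnInterval (fun t => (γ t).fiber) a b :=
  AbsolutelyContinuousOnInterval.of_dist_le (C := 1) h.ac fun s _ t _ => by
    rw [one_mul, dist_def]
    exact le_add_of_nonneg_left (abs_nonneg _)

theorem IsConeCurve.ae_abs_deriv_le (h : IsConeCurve γ a b) :
    ∀ᵐ t ∂(volume.restrict (Icc a b)),
      |deriv (fun s => dist (γ s).fiber (γ a).fiber) t| ≤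
        metricDeriv (fun s => (γ s).fiber) t :=
  ae_restrict_Icc_of_Ioo
    (AbsolutelyContinuousOnInterval.ae_abs_deriv_dist_le_metricDeriv h.lt.le h.ac_fiber _)

/-- The calibration bound: its pointwise form is `mul_sqrt_add_mul_le` divided by `F`, and both
terms on the right integrate to endpoint data. -/
theorem length_le (hc : IsCausal γ a b) (hf : IsFutureDirected γ a b) {F : ℝ → ℝ}
    (hF : Continuous F) (hF0 : ∀ t, 0 < F t)
    (hFf : EqOn f F (Icc (γ a).base (γ b).base)) {l : ℝ} (hl : 0 ≤ l) :
    length γ a b ≤ ENNReal.ofReal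
      ((∫ t in (γ a).base..(γ b).base, √(F t ^ 2 + l ^ 2) / F t) -
        l * dist (γ b).fiber (γ a).fiber) := by
  have hab := hc.1.lt.le
  obtain ⟨hi, hint⟩ :=
    AbsolutelyContinuousOnInterval.integral_comp_mul_deriv_of_monotoneOn
      (h := fun t => √(F t ^ 2 + l ^ 2) / F t) hab
      hc.1.ac_base hf.1.monotoneOn
      (Continuous.div (by fun_prop) hF fun t => (hF0 t).ne')
  have hg := AbsolutelyContinuousOnInterval.dist_const hc.1.ac_fiber (γ a).fiber
  have hgi := AbsolutelyContinuousOnInterval.intervalIntegrable_deriv hg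
  have hgint := AbsolutelyContinuousOnInterval.integral_deriv_eq_sub hg
  rw [dist_self, sub_zero] at hgint
  rw [← hint, ← hgint, ← intervalIntegral.integral_const_mul,
    ← intervalIntegral.integral_sub hi (hgi.const_mul l)]
  have hpt : ∀ᵐ t ∂(volume.restrict (Icc a b)), √(-velocitySq γ t) ≤
      √(F (γ t).base ^ 2 + l ^ 2) / F (γ t).base * deriv (fun s => (γ s).base) t -
        l * deriv (fun s => dist (γ s).fiber (γ a).fiber) t := by
    filter_upwards [hc.2, hf.2, hc.1.ae_abs_deriv_le, ae_restrict_mem measurableSet_Icc]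
      with t h1 h2 h3 htI
    have hFp := hF0 (γ t).base
    rw [velocitySq, hFf (base_mem_Icc hf.1 htI)] at h1 ⊢
    have hv := (abs_nonneg _).trans h3
    have hlg := mul_le_mul_of_nonneg_left ((le_abs_self _).trans h3) hl
    have hcs := mul_sqrt_add_mul_le (F (γ t).base) l _ (metricDeriv (fun s => (γ s).fiber) t)
      h2.le (by rw [mul_pow]; linarith)
    rw [show -(-(deriv (fun s => (γ s).base) t) ^ 2 +
      F (γ t).base ^ 2 * metricDeriv (fun s => (γ s).fiber) t ^ 2) =
      deriv (fun s => (γ s).base) t ^ 2 -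
        (F (γ t).base * metricDeriv (fun s => (γ s).fiber) t) ^ 2 by ring]
    refine le_trans ?_ (sub_le_sub_left hlg _)
    rw [le_sub_iff_add_le, div_mul_eq_mul_div, le_div_iff₀ hFp]
    linarith
  have hint' := hi.sub (hgi.const_mul l)
  rw [intervalIntegrable_iff_integrableOn_Icc_of_le hab] at hint'
  rw [intervalIntegral.integral_of_le hab, ← integral_Icc_eq_integral_Ioc,
    ofReal_integral_eq_lintegral_ofReal hint'
      (by filter_upwards [hpt] with t ht using (Real.sqrt_nonneg _).trans ht), length]
  refine lintegral_mono_ae ?_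
  filter_upwards [hpt] with t ht using ENNReal.ofReal_le_ofReal ht

theorem timeSep_le {F : ℝ → ℝ} (hF : Continuous F) (hF0 : ∀ t, 0 < F t) {p q : GenCone I f X}
    (hFf : EqOn f F (Icc p.base q.base)) {l : ℝ} (hl : 0 ≤ l) :
    timeSep p q ≤ ENNReal.ofReal
      ((∫ t in p.base..q.base, √(F t ^ 2 + l ^ 2) / F t) - l * dist p.fiber q.fiber) := by
  refine iSup_le fun a => iSup_le fun b => iSup_le fun γ => iSup_le fun h => ?_
  obtain ⟨hc, hf, rfl, rfl⟩ := h
  rw [dist_comm]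
  exact length_le hc hf hF hF0 hFf hl

theorem integral_inv_comp_mul_deriv (hc : IsCausal γ a b) (hf : IsFutureDirected γ a b)
    {F : ℝ → ℝ} (hF : Continuous F) (hF0 : ∀ t, 0 < F t) :
    IntervalIntegrable (fun t => (F (γ t).base)⁻¹ * deriv (fun s => (γ s).base) t) volume a b ∧
      ∫ t in a..b, (F (γ t).base)⁻¹ * deriv (fun s => (γ s).base) t =
        ∫ t in (γ a).base..(γ b).base, (F t)⁻¹ :=
  AbsolutelyContinuousOnInterval.integral_comp_mul_deriv_of_monotoneOn
    (h := fun t => (F t)⁻¹) hc.1.lt.le hc.1.ac_base hf.1.monotoneOn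
    (hF.inv₀ fun t => (hF0 t).ne')

theorem dist_fiber_le_integral (hc : IsCausal γ a b) (hf : IsFutureDirected γ a b) {F : ℝ → ℝ}
    (hF : Continuous F) (hF0 : ∀ t, 0 < F t)
    (hFf : EqOn f F (Icc (γ a).base (γ b).base)) :
    dist (γ b).fiber (γ a).fiber ≤ ∫ t in (γ a).base..(γ b).base, (F t)⁻¹ := by
  obtain ⟨hi, hint⟩ := integral_inv_comp_mul_deriv hc hf hF hF0
  have hg := AbsolutelyContinuousOnInterval.dist_const hc.1.ac_fiber (γ a).fiber
  have hgi := AbsolutelyContinuousOnInterval.intervalIntegrable_deriv hg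
  have hgint := AbsolutelyContinuousOnInterval.integral_deriv_eq_sub hg
  rw [dist_self, sub_zero] at hgint
  rw [← hint, ← hgint]
  refine intervalIntegral.integral_mono_ae_restrict hc.1.lt.le hgi hi ?_
  filter_upwards [hc.2, hf.2, hc.1.ae_abs_deriv_le, ae_restrict_mem measurableSet_Icc]
    with t h1 h2 h3 htI
  have hFp := hF0 (γ t).base
  rw [velocitySq, hFf (base_mem_Icc hf.1 htI)] at h1
  refine ((le_abs_self _).trans h3).trans ?_
  rw [inv_mul_eq_div, le_div_iff₀ hFp]
  exact (le_abs_self _).trans (abs_le_of_sq_le_sq (by rw [mul_pow]; linarith) h2.le)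

theorem dist_fiber_lt_integral (hc : IsTimelike γ a b) (hf : IsFutureDirected γ a b) {F : ℝ → ℝ}
    (hF : Continuous F) (hF0 : ∀ t, 0 < F t)
    (hFf : EqOn f F (Icc (γ a).base (γ b).base)) :
    dist (γ b).fiber (γ a).fiber < ∫ t in (γ a).base..(γ b).base, (F t)⁻¹ := by
  have hc' : IsCausal γ a b := ⟨hc.1, hc.2.mono fun t ht => ht.le⟩
  obtain ⟨hi, hint⟩ := integral_inv_comp_mul_deriv hc' hf hF hF0
  have hg := AbsolutelyContinuousOnInterval.dist_const hc.1.ac_fiber (γ a).fiber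
  have hgi := AbsolutelyContinuousOnInterval.intervalIntegrable_deriv hg
  have hgint := AbsolutelyContinuousOnInterval.integral_deriv_eq_sub hg
  rw [dist_self, sub_zero] at hgint
  rw [← hint, ← hgint]
  have hlt : ∀ᵐ t ∂(volume.restrict (Ioc a b)),
      deriv (fun s => dist (γ s).fiber (γ a).fiber) t <
        (F (γ t).base)⁻¹ * deriv (fun s => (γ s).base) t := by
    rw [restrict_Ioc_eq_restrict_Icc]
    filter_upwards [hc.2, hf.2, hc.1.ae_abs_deriv_le, ae_restrict_mem measurableSet_Icc]
      with t h1 h2 h3 htI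
    have hFp := hF0 (γ t).base
    rw [velocitySq, hFf (base_mem_Icc hf.1 htI)] at h1
    refine ((le_abs_self _).trans h3).trans_lt ?_
    rw [inv_mul_eq_div, lt_div_iff₀ hFp]
    exact lt_of_pow_lt_pow_left₀ 2 h2.le (by rw [mul_pow]; linarith)
  refine intervalIntegral.integral_lt_integral_of_ae_le_of_measure_setOfPred_lt_ne_zero hc.1.lt.le
    hgi hi (hlt.mono fun t ht => ht.le) ?_
  -- Strict inequality of the integrals needs a set of positive measure; here strictness holds
  -- almost everywhere on `(a, b]`.
  rw [measure_eq_measure_of_null_sdiff (subset_univ _) (by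
    rw [← compl_eq_univ_sdiff]
    exact hlt)]
  simp [hc.1.lt]

/-! ### Criterion for maximality -/

theorem IsCausal.mono (hc : IsCausal γ a b) {c d : ℝ} (hac : a ≤ c) (hcd : c < d) (hdb : d ≤ b) :
    IsCausal γ c d := by
  have hsub : Icc c d ⊆ Icc a b := Icc_subset_Icc hac hdb
  refine ⟨⟨hcd, AbsolutelyContinuousOnInterval.mono hc.1.ac ?_, ?_⟩,
    ae_restrict_of_ae_restrict_of_subset hsub hc.2⟩
  · rwa [uIcc_of_le hcd.le, uIcc_of_le hc.1.lt.le]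
  · exact hc.1.mono.imp (fun h => h.mono hsub) fun h => h.mono hsub

theorem length_le_timeSep (hc : IsCausal γ a b) (hf : IsFutureDirected γ a b) :
    length γ a b ≤ timeSep (γ a) (γ b) :=
  le_iSup_of_le a <| le_iSup_of_le b <| le_iSup_of_le γ <| le_iSup_of_le ⟨hc, hf, rfl, rfl⟩ le_rfl

theorem length_le_add (γ : ℝ → GenCone I f X) {a b c : ℝ} (hab : a ≤ b) (hbc : b ≤ c) :
    length γ a c ≤ length γ a b + length γ b c := by
  rw [length, ← Icc_union_Icc_eq_Icc hab hbc]
  exact lintegral_union_le _ _ _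

theorem length_le_tauLength (hc : IsCausal γ a b) (hf : IsFutureDirected γ a b) :
    length γ a b ≤ tauLength γ a b := by
  refine le_iInf fun N => le_iInf fun t => le_iInf fun h => ?_
  obtain ⟨h0, hN, hlt⟩ := h
  have hmono : ∀ i j, i ≤ j → j ≤ N → t i ≤ t j := by
    intro i j hij
    induction j, hij using Nat.le_induction with
    | base => exact fun _ => le_rfl
    | succ j hij ih => exact fun hj => (ih (by omega)).trans (hlt j (by omega)).le
  have key : ∀ n ≤ N, length γ (t 0) (t n) ≤
      ∑ i ∈ Finset.range n, timeSep (γ (t i)) (γ (t (i + 1))) := by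
    intro n
    induction n with
    | zero => simp [length]
    | succ n ih =>
      intro hn
      rw [Finset.sum_range_succ]
      refine (length_le_add γ (hmono 0 n (by omega) (by omega))
        (hlt n (by omega)).le).trans (add_le_add (ih (by omega)) ?_)
      have h1 : a ≤ t n := h0 ▸ hmono 0 n (by omega) (by omega)
      have h2 : t (n + 1) ≤ b := hN ▸ hmono (n + 1) N hn le_rfl
      exact length_le_timeSep (hc.mono h1 (hlt n (by omega)) h2) (hf.mono h1 h2)
  have := key N le_rfl
  rwa [h0, hN] at this

theorem tauLength_le_timeSep (γ : ℝ → GenCone I f X) (hab : a < b) :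
    tauLength γ a b ≤ timeSep (γ a) (γ b) := by
  refine iInf_le_of_le 1 <| iInf_le_of_le (fun i => if i = 0 then a else b) <|
    iInf_le_of_le ⟨by simp, by simp, ?_⟩ ?_
  · intro i hi
    obtain rfl : i = 0 := by omega
    simpa using hab
  · simp

/-- In general `L ≤ L_τ ≤ τ`: subadditivity of `L` over a partition gives the first inequality, the
trivial partition the second. Hence `τ ≤ L` forces all three to agree. -/
theorem IsMaximal.of_timeSep_le (hc : IsCausal γ a b) (hf : IsFutureDirected γ a b)
    (h : timeSep (γ a) (γ b) ≤ length γ a b) : IsMaximal γ a b :=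
  ⟨hc, hf, (length_le_timeSep hc hf).antisymm h,
    (tauLength_le_timeSep γ hc.1.lt).antisymm (h.trans (length_le_tauLength hc hf))⟩

theorem IsMaximal.isGeodesic (h : IsMaximal γ a b) : IsGeodesic γ a b :=
  ⟨h.1, h.2.1, fun _ _ => ⟨a, b, le_rfl, h.1.1.lt, le_rfl, self_mem_nhdsWithin, h⟩⟩

end GenCone

/-! ### Extending the warping function and choosing the multiplier -/

theorem ContinuousOn.exists_continuous_pos_extension {f : ℝ → ℝ} {a b : ℝ} (hab : a ≤ b)
    (hf : ContinuousOn f (Icc a b)) (hpos : ∀ t ∈ Icc a b, 0 < f t) :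
    ∃ F : ℝ → ℝ, Continuous F ∧ (∀ t, 0 < F t) ∧ EqOn f F (Icc a b) :=
  ⟨IccExtend hab ((Icc a b).domRestrict f), hf.domRestrict.Icc_extend',
    fun t => hpos _ (projIcc a b hab t).2, fun t ht => by
      rw [IccExtend_of_mem _ _ ht, domRestrict_apply]⟩

theorem exists_integral_div_mul_sqrt_eq {F : ℝ → ℝ} (hF : Continuous F) (hF0 : ∀ t, 0 < F t)
    {a b : ℝ} (hab : a ≤ b) {d : ℝ} (hd : 0 ≤ d) (hdlt : d < ∫ t in a..b, (F t)⁻¹) :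
    ∃ l, 0 ≤ l ∧ ∫ t in a..b, l / (F t * √(F t ^ 2 + l ^ 2)) = d := by
  have hS : ∀ l t, 0 < √(F t ^ 2 + l ^ 2) := fun l t => by
    have := hF0 t
    positivity
  have hcont : Continuous fun l => ∫ t in a..b, l / (F t * √(F t ^ 2 + l ^ 2)) := by
    refine intervalIntegral.continuous_parametric_intervalIntegral_of_continuous' ?_ a b
    exact Continuous.div (by fun_prop) (by fun_prop) fun x =>
      (mul_pos (hF0 _) (hS _ _)).ne'
  obtain ⟨M, hM⟩ := isCompact_Icc.bddAbove_image (hF.continuousOn (s := Icc a b))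
  have hFM : ∀ t ∈ Icc a b, F t ≤ M := fun t ht => hM (mem_image_of_mem _ ht)
  have hM0 : 0 < M := (hF0 a).trans_le (hFM a (left_mem_Icc.2 hab))
  set J := ∫ t in a..b, (F t)⁻¹
  have hJd : 0 < J - d := sub_pos.2 hdlt
  -- Since `√(F² + B²) ≤ M + B`, the integral at `l = B` is at least `B/(M + B) * J`. This `B`
  -- solves `B/(M + B) * J = d`, giving the upper end for the intermediate value theorem.
  obtain ⟨B, hB⟩ : ∃ B, B = d * M / (J - d) := ⟨_, rfl⟩
  have hB0 : 0 ≤ B := by rw [hB]; positivity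
  have hBJ : B / (M + B) * J = d := by
    have h1 : B * (J - d) = d * M := by rw [hB]; field_simp
    field_simp
    linarith
  have hGB : d ≤ ∫ t in a..b, B / (F t * √(F t ^ 2 + B ^ 2)) := by
    rw [← hBJ, ← intervalIntegral.integral_const_mul]
    refine intervalIntegral.integral_mono_on hab (Continuous.intervalIntegrable
      (continuous_const.mul (hF.inv₀ fun t => (hF0 t).ne')) _ _)
      (Continuous.intervalIntegrable (Continuous.div (by fun_prop) (by fun_prop) fun t =>
        (mul_pos (hF0 _) (hS _ _)).ne') _ _) fun t ht => ?_
    have hFt := hF0 t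
    have h2 : √(F t ^ 2 + B ^ 2) ≤ M + B := by
      rw [Real.sqrt_le_left (by positivity)]
      nlinarith [hFM t ht]
    rw [← div_eq_mul_inv, div_div, mul_comm (M + B)]
    exact div_le_div_of_nonneg_left hB0 (mul_pos hFt (hS _ _)) (by gcongr)
  have hG0 : ∫ t in a..b, (0 : ℝ) / (F t * √(F t ^ 2 + 0 ^ 2)) ≤ d := by simpa using hd
  obtain ⟨l, hl, hle⟩ := intermediate_value_Icc hB0 hcont.continuousOn ⟨hG0, hGB⟩
  exact ⟨l, hl.1, hle⟩

/-! ### Construction of maximal curves -/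

namespace GenCone

variable {I : Set ℝ} {f : ℝ → ℝ} {X : Type*} [MetricSpace X]

/-- The curve over the base `[p.base, q.base]` which follows a minimizer of the fibre with a
prescribed continuous speed. -/
theorem exists_curve_of_speed (hX : IsGeodesicSpace X) (hI : I.OrdConnected)
    (p q : GenCone I f X) (hpq : p.base < q.base) {v : ℝ → ℝ} (hv : Continuous v)
    (hv0 : ∀ t, 0 ≤ v t) (hvd : ∫ t in p.base..q.base, v t = dist p.fiber q.fiber) :
    ∃ γ : ℝ → GenCone I f X, γ p.base = p ∧ γ q.base = q ∧
      IsConeCurve γ p.base q.base ∧ IsFutureDirected γ p.base q.base ∧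
      (∃ K : ℝ≥0, LipschitzOnWith K γ (Icc p.base q.base)) ∧
      ∀ t ∈ Ioo p.base q.base, velocitySq γ t = -1 + (f t * v t) ^ 2 := by
  obtain ⟨c, hc0, hc1, hc⟩ := hX p.fiber q.fiber
  set a := p.base with ha
  set b := q.base with hb
  -- Clamping the base coordinate keeps the curve inside `I` for every real parameter.
  have hmem : ∀ t, max a (min t b) ∈ I := fun t =>
    hI.out p.base_mem q.base_mem ⟨le_max_left _ _, max_le hpq.le (min_le_right _ _)⟩
  obtain ⟨φ, hφ⟩ : ∃ φ : ℝ → ℝ, φ = fun t => ∫ u in a..t, v u := ⟨_, rfl⟩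
  have hφd : ∀ t, HasDerivAt φ (v t) t := fun t => by
    rw [hφ]
    exact intervalIntegral.integral_hasDerivAt_right (hv.intervalIntegrable _ _)
      hv.aestronglyMeasurable.stronglyMeasurableAtFilter hv.continuousAt
  have hφC : ContDiff ℝ 1 φ := by
    rw [contDiff_one_iff_deriv]
    refine ⟨fun x => (hφd x).differentiableAt, ?_⟩
    rwa [show deriv φ = v from funext fun x => (hφd x).deriv]
  have hφmono : Monotone φ := monotone_of_hasDerivAt_nonneg hφd hv0
  have hφa : φ a = 0 := by simp [hφ]
  have hφb : φ b = dist p.fiber q.fiber := by rw [hφ]; exact hvd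
  have hφmem : ∀ t ∈ Icc a b, φ t ∈ Icc 0 (dist p.fiber q.fiber) := fun t ht =>
    ⟨hφa ▸ hφmono ht.1, hφb ▸ hφmono ht.2⟩
  obtain ⟨γ, hγ⟩ : ∃ γ : ℝ → GenCone I f X,
    γ = fun t => ⟨max a (min t b), hmem t, c (φ t)⟩ := ⟨_, rfl⟩
  have hbase : ∀ t ∈ Icc a b, (γ t).base = t := fun t ht => by simp [hγ, ht.1, ht.2]
  have hfib : ∀ s ∈ Icc a b, ∀ t ∈ Icc a b, dist (γ s).fiber (γ t).fiber = |φ s - φ t| :=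
    fun s hs t ht => by
      simp only [hγ]
      exact hc _ (hφmem s hs) _ (hφmem t ht)
  have hderiv : ∀ t ∈ Ioo a b, deriv (fun s => (γ s).base) t = 1 := fun t ht => by
    have : (fun s => (γ s).base) =ᶠ[𝓝 t] id := by
      filter_upwards [Icc_mem_nhds ht.1 ht.2] with s hs using hbase s hs
    rw [this.deriv_eq, deriv_id]
  have hstrict : StrictMonoOn (fun s => (γ s).base) (Icc a b) := fun s hs t ht hst => by
    simpa only [hbase s hs, hbase t ht] using hst
  obtain ⟨K, hK⟩ := (hφC.contDiffOn (s := Icc a b)).exists_lipschitzOnWith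
    (by decide) (convex_Icc _ _) isCompact_Icc
  have hLip : LipschitzOnWith (1 + K) γ (Icc a b) := by
    refine LipschitzOnWith.of_dist_le_mul fun s hs t ht => ?_
    have h1 := hK.dist_le_mul s hs t ht
    rw [Real.dist_eq] at h1
    rw [dist_def, hfib s hs t ht, hbase s hs, hbase t ht, Real.dist_eq] at *
    push_cast
    linarith
  have haI := left_mem_Icc.2 hpq.le
  have hbI := right_mem_Icc.2 hpq.le
  refine ⟨γ, GenCone.ext (hbase a haI) ?_, GenCone.ext (hbase b hbI) ?_,
    ⟨hpq, LipschitzOnWith.absolutelyContinuousOnInterval (K := 1 + K)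
      (by rwa [uIcc_of_le hpq.le]), Or.inl hstrict⟩,
    ⟨hstrict, ae_restrict_Icc_of_Ioo (Eventually.of_forall fun t ht => ?_)⟩,
    ⟨1 + K, hLip⟩, fun t ht => ?_⟩
  · simp [hγ, hφa, hc0]
  · simp [hγ, hφb, hc1]
  · rw [hderiv t ht]
    exact one_pos
  · have htI := Ioo_subset_Icc_self ht
    have hmd : metricDeriv (fun s => (γ s).fiber) t = v t := by
      refine Tendsto.limUnder_eq ?_
      have := (hφd t).tendsto_abs_sub_div
      rw [abs_of_nonneg (hv0 t)] at this
      refine this.congr' ?_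
      filter_upwards [mem_nhdsWithin_of_mem_nhds (Icc_mem_nhds ht.1 ht.2)] with s hs
      rw [hfib s hs t htI]
    rw [velocitySq, hderiv t ht, hmd, hbase t htI]
    ring

/-- The speed `l/(F √(F² + l²))` is the equality case of the calibration. The curve's proper-time
density is then `F/√(F² + l²) > 0`, which equals `√(F² + l²)/F - l v`. -/
theorem exists_isMaximal_isTimelike (hX : IsGeodesicSpace X) (hI : I.OrdConnected)
    (p q : GenCone I f X) (hpq : p.base < q.base) {F : ℝ → ℝ} (hF : Continuous F)
    (hF0 : ∀ t, 0 < F t) (hFf : EqOn f F (Icc p.base q.base))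
    (hlt : dist p.fiber q.fiber < ∫ t in p.base..q.base, (F t)⁻¹) :
    ∃ γ : ℝ → GenCone I f X, γ p.base = p ∧ γ q.base = q ∧
      IsTimelike γ p.base q.base ∧ IsMaximal γ p.base q.base ∧
      ∃ K : ℝ≥0, LipschitzOnWith K γ (Icc p.base q.base) := by
  obtain ⟨l, hl, hld⟩ := exists_integral_div_mul_sqrt_eq hF hF0 hpq.le dist_nonneg hlt
  have hS : ∀ t, 0 < √(F t ^ 2 + l ^ 2) := fun t => by
    have := hF0 t
    positivity
  have hS2 : ∀ t, √(F t ^ 2 + l ^ 2) ^ 2 = F t ^ 2 + l ^ 2 := fun t =>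
    Real.sq_sqrt (by positivity)
  have hvc : Continuous fun t => l / (F t * √(F t ^ 2 + l ^ 2)) :=
    Continuous.div (by fun_prop) (by fun_prop) fun t => (mul_pos (hF0 t) (hS t)).ne'
  obtain ⟨γ, hγp, hγq, hcone, hfut, hLip, hvel⟩ := exists_curve_of_speed hX hI p q hpq hvc
    (fun t => div_nonneg hl (mul_pos (hF0 t) (hS t)).le) hld
  have hvel' : ∀ t ∈ Ioo p.base q.base,
      -velocitySq γ t = (F t / √(F t ^ 2 + l ^ 2)) ^ 2 := fun t ht => by
    have h0 := hF0 t
    have h1 := hS t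
    have h2 := hS2 t
    rw [hvel t ht, hFf (Ioo_subset_Icc_self ht)]
    set S := √(F t ^ 2 + l ^ 2)
    field_simp
    linarith
  have htime : IsTimelike γ p.base q.base := by
    refine ⟨hcone, ae_restrict_Icc_of_Ioo (Eventually.of_forall fun t ht => ?_)⟩
    have h1 : 0 < (F t / √(F t ^ 2 + l ^ 2)) ^ 2 := pow_pos (div_pos (hF0 t) (hS t)) 2
    linarith [hvel' t ht]
  have hcausal : IsCausal γ p.base q.base := ⟨hcone, htime.2.mono fun t ht => ht.le⟩
  refine ⟨γ, hγp, hγq, htime, IsMaximal.of_timeSep_le hcausal hfut ?_, hLip⟩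
  rw [hγp, hγq]
  refine (timeSep_le hF hF0 hFf hl).trans (le_of_eq ?_)
  have hlen : length γ p.base q.base =
      ∫⁻ t in Icc p.base q.base, ENNReal.ofReal (F t / √(F t ^ 2 + l ^ 2)) := by
    refine lintegral_congr_ae (ae_restrict_Icc_of_Ioo (Eventually.of_forall fun t ht => ?_))
    simp only [hvel' t ht, Real.sqrt_sq (div_pos (hF0 t) (hS t)).le]
  have hc1 : Continuous fun t => F t / √(F t ^ 2 + l ^ 2) :=
    Continuous.div (by fun_prop) (by fun_prop) fun t => (hS t).ne'
  have hc2 : Continuous fun t => √(F t ^ 2 + l ^ 2) / F t :=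
    Continuous.div (by fun_prop) (by fun_prop) fun t => (hF0 t).ne'
  rw [hlen, ← ofReal_integral_eq_lintegral_ofReal (hc1.integrableOn_Icc)
    (Eventually.of_forall fun t => (div_pos (hF0 t) (hS t)).le),
    integral_Icc_eq_integral_Ioc, ← intervalIntegral.integral_of_le hpq.le, ← hld,
    ← intervalIntegral.integral_const_mul, ← intervalIntegral.integral_sub
      (hc2.intervalIntegrable _ _) ((hvc.intervalIntegrable _ _).const_mul l)]
  congr 1
  refine intervalIntegral.integral_congr fun t _ => ?_
  have h0 := hF0 t
  have h1 := hS t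
  have h2 := hS2 t
  set S := √(F t ^ 2 + l ^ 2)
  field_simp
  linarith

/-- With `d = ∫ 1/F` the calibration bound is `∫ (√(F² + l²) - l)/F`. As `√(F² + l²) - l ≤ F²/(2l)`,
it is at most `(∫ F)/(2l)`, which vanishes as `l → ∞`. -/
theorem timeSep_eq_zero {F : ℝ → ℝ} (hF : Continuous F)
    (hF0 : ∀ t, 0 < F t) {p q : GenCone I f X} (hpq : p.base ≤ q.base)
    (hFf : EqOn f F (Icc p.base q.base))
    (h : dist p.fiber q.fiber = ∫ t in p.base..q.base, (F t)⁻¹) : timeSep p q = 0 := by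
  have key : ∀ l : ℝ, 0 < l → timeSep p q ≤
      ENNReal.ofReal ((∫ t in p.base..q.base, F t) / 2 * l⁻¹) := by
    intro l hl
    refine (timeSep_le hF hF0 hFf hl.le).trans (ENNReal.ofReal_le_ofReal ?_)
    have hci : Continuous fun t => (F t)⁻¹ := hF.inv₀ fun t => (hF0 t).ne'
    have hc2 : Continuous fun t => √(F t ^ 2 + l ^ 2) / F t :=
      Continuous.div (by fun_prop) (by fun_prop) fun t => (hF0 t).ne'
    rw [h, ← intervalIntegral.integral_const_mul, ← intervalIntegral.integral_sub
      (hc2.intervalIntegrable _ _) ((hci.intervalIntegrable _ _).const_mul l),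
      div_mul_eq_mul_div, mul_div_assoc, ← intervalIntegral.integral_mul_const]
    refine intervalIntegral.integral_mono_on hpq
      ((hc2.intervalIntegrable _ _).sub ((hci.intervalIntegrable _ _).const_mul l))
      ((hF.intervalIntegrable _ _).mul_const _) fun t _ => ?_
    have h0 := hF0 t
    have h1 : √(F t ^ 2 + l ^ 2) ≤ l + F t ^ 2 / (2 * l) := by
      rw [Real.sqrt_le_left (by positivity)]
      have : (l + F t ^ 2 / (2 * l)) ^ 2 = F t ^ 2 + l ^ 2 + (F t ^ 2 / (2 * l)) ^ 2 := by
        field_simp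
        ring
      nlinarith [sq_nonneg (F t ^ 2 / (2 * l))]
    calc √(F t ^ 2 + l ^ 2) / F t - l * (F t)⁻¹
        ≤ (l + F t ^ 2 / (2 * l)) / F t - l * (F t)⁻¹ := by gcongr
      _ = F t * (l⁻¹ / 2) := by
        field_simp
        ring
  have hlim : Tendsto (fun l : ℝ => ENNReal.ofReal ((∫ t in p.base..q.base, F t) / 2 * l⁻¹))
      atTop (𝓝 0) := by
    have := (tendsto_inv_atTop_zero (𝕜 := ℝ)).const_mul ((∫ t in p.base..q.base, F t) / 2)
    rw [mul_zero] at this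
    simpa using ENNReal.tendsto_ofReal this
  refine le_antisymm (ge_of_tendsto hlim ?_) (zero_le)
  filter_upwards [eventually_gt_atTop 0] with l hl using key l hl

theorem exists_isMaximal_of_eq (hX : IsGeodesicSpace X) (hI : I.OrdConnected)
    (p q : GenCone I f X) (hpq : p.base < q.base) {F : ℝ → ℝ} (hF : Continuous F)
    (hF0 : ∀ t, 0 < F t) (hFf : EqOn f F (Icc p.base q.base))
    (h : dist p.fiber q.fiber = ∫ t in p.base..q.base, (F t)⁻¹) :
    ∃ γ : ℝ → GenCone I f X, γ p.base = p ∧ γ q.base = q ∧ IsMaximal γ p.base q.base ∧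
      ∃ K : ℝ≥0, LipschitzOnWith K γ (Icc p.base q.base) := by
  obtain ⟨γ, hγp, hγq, hcone, hfut, hLip, hvel⟩ := exists_curve_of_speed hX hI p q hpq
    (v := fun t => (F t)⁻¹) (hF.inv₀ fun t => (hF0 t).ne') (fun t => (inv_pos.2 (hF0 t)).le) h.symm
  have hcausal : IsCausal γ p.base q.base := by
    refine ⟨hcone, ae_restrict_Icc_of_Ioo (Eventually.of_forall fun t ht => ?_)⟩
    rw [hvel t ht, hFf (Ioo_subset_Icc_self ht), mul_inv_cancel₀ (hF0 t).ne']
    norm_num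
  refine ⟨γ, hγp, hγq, IsMaximal.of_timeSep_le hcausal hfut ?_, hLip⟩
  rw [hγp, hγq, timeSep_eq_zero hF hF0 hpq.le hFf h]
  exact zero_le

end GenCone

theorem mainTheorem12 {X : Type*} [MetricSpace X] (hX : IsGeodesicSpace X)
    (I : Set ℝ) (hIopen : IsOpen I) (hIconn : I.OrdConnected)
    (f : ℝ → ℝ) (hfcont : ContinuousOn f I) (hfpos : ∀ t ∈ I, 0 < f t) :
    (∀ p q : GenCone I f X, GenCone.CausallyRelated p q → p ≠ q →
      ∃ (a b : ℝ) (γ : ℝ → GenCone I f X), γ a = p ∧ γ b = q ∧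
        GenCone.IsMaximal γ a b ∧ ∃ K : ℝ≥0, LipschitzOnWith K γ (Icc a b)) ∧
    (∀ p q : GenCone I f X, GenCone.TimelikeRelated p q →
      ∃ (a b : ℝ) (γ : ℝ → GenCone I f X), γ a = p ∧ γ b = q ∧
        GenCone.IsTimelike γ a b ∧ GenCone.IsGeodesic γ a b ∧ GenCone.IsMaximal γ a b ∧
        ∃ K : ℝ≥0, LipschitzOnWith K γ (Icc a b)) := by
  have ext : ∀ p q : GenCone I f X, p.base < q.base → ∃ F : ℝ → ℝ, Continuous F ∧
      (∀ t, 0 < F t) ∧ EqOn f F (Icc p.base q.base) := fun p q hpq => by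
    have hsub : Icc p.base q.base ⊆ I := hIconn.out p.base_mem q.base_mem
    exact (hfcont.mono hsub).exists_continuous_pos_extension hpq.le
      fun t ht => hfpos t (hsub ht)
  have hlt : ∀ {γ : ℝ → GenCone I f X} {a b : ℝ}, GenCone.IsCausal γ a b →
      GenCone.IsFutureDirected γ a b → (γ a).base < (γ b).base := fun hc hf =>
    hf.1 (left_mem_Icc.2 hc.1.lt.le) (right_mem_Icc.2 hc.1.lt.le) hc.1.lt
  constructor
  · rintro p q (⟨a, b, γ, hc, hf, rfl, rfl⟩ | rfl) hne
    · have hpq := hlt hc hf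
      obtain ⟨F, hF, hF0, hFf⟩ := ext _ _ hpq
      have hd := GenCone.dist_fiber_le_integral hc hf hF hF0 hFf
      rw [dist_comm] at hd
      -- The strict case admits a finite multiplier; equality is the null case, corresponding to `l
      -- = ∞`.
      rcases hd.lt_or_eq with hd | hd
      · obtain ⟨σ, h1, h2, -, h3, h4⟩ :=
          GenCone.exists_isMaximal_isTimelike hX hIconn _ _ hpq hF hF0 hFf hd
        exact ⟨_, _, σ, h1, h2, h3, h4⟩
      · obtain ⟨σ, h⟩ := GenCone.exists_isMaximal_of_eq hX hIconn _ _ hpq hF hF0 hFf hd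
        exact ⟨_, _, σ, h⟩
    · exact absurd rfl hne
  · rintro p q ⟨a, b, γ, hc, hf, rfl, rfl⟩
    have hpq := hlt ⟨hc.1, hc.2.mono fun t ht => ht.le⟩ hf
    obtain ⟨F, hF, hF0, hFf⟩ := ext _ _ hpq
    have hd := GenCone.dist_fiber_lt_integral hc hf hF hF0 hFf
    rw [dist_comm] at hd
    obtain ⟨σ, h1, h2, h3, h4, h5⟩ :=
      GenCone.exists_isMaximal_isTimelike hX hIconn _ _ hpq hF hF0 hFf hd
    exact ⟨_, _, σ, h1, h2, h3, h4.isGeodesic, h4, h5⟩
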